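/- Let $G$ be a countable discrete group acting by $*$-automorphisms on a (not necessarily unital) $C^*$-algebra $A$. Let $A\rtimes_r G$ be the reduced crossed product, i.e. for a faithful representation $\pi\colon A\to B(H)$ on a Hilbert space, the norm closure in $B(\ell^2(G,H))$ of the $*$-algebra $C_c(G,A)$ of finite sums $\sum_{t\in G} a_tu_t$ ($a_t\in A$), where $a \in A$ acts by $(a\xi)(t)=\pi(t^{-1}.a)\,\xi(t)$ and $(u_s\xi)(t)=\xi(s^{-1}t)$; identify $a\in A$ with $au_e$. Let $E\colon A\rtimes_r G\to A$ be the canonical conditional expectation, i.e. the continuous linear map with $E\big(\sum_{t} a_tu_t\big)=a_e$ on $C_c(G,A)$. A *tracial weight* on a $C^*$-algebra $B$ is a map $\varphi\colon B^+\to[0,\infty]$ such that $\varphi(\alpha a+\beta b)=\alpha\varphi(a)+\beta\varphi(b)$ for all $a,b\in B^+$ and $\alpha,\beta\in[0,\infty)$ (with $0\cdot\infty=0$), and $\varphi(x^*x)=\varphi(xx^*)$ for all $x\in B$. Let $\varphi_0\colon A^+\to[0,\infty]$ be a lower semicontinuous tracial weight that is $G$-invariant, i.e. $\varphi_0(t.a)=\varphi_0(a)$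 for all $t\in G$ and $a\in A^+$. Then the mapping $\varphi=\varphi_0\circ E\colon (A\rtimes_r G)^+\to[0,\infty]$ is a lower semicontinuous tracial weight, and it extends $\varphi_0$, i.e. $\varphi(a)=\varphi_0(a)$ for all $a\in A^+$. -/

import Mathlib

open scoped ENNReal NNReal InnerProductSpace

noncomputable section

set_option linter.unusedSectionVars false

/-! ### Operators on Hilbert space direct sums -/

namespace L2Sum

variable {ι : Type*} {H : ι → Type*} [∀ i, NormedAddCommGroup (H i)]
  [∀ i, InnerProductSpace ℂ (H i)]

theorem memℓp_diag (T : ∀ i, H i →L[ℂ] H i) (C : ℝ) (hC : ∀ i, ‖T i‖ ≤ C) (f : lp H 2) :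
    Memℓp (fun i => T i (f i)) 2 := by
  have hf := (lp.memℓp f).summable (by norm_num)
  refine memℓp_gen (Summable.of_nonneg_of_le (fun i => by positivity) (fun i => ?_)
    (hf.mul_left (C ^ (2 : ℝ≥0∞).toReal)))
  have hC0 : 0 ≤ C := (norm_nonneg _).trans (hC i)
  rw [← Real.mul_rpow hC0 (norm_nonneg _)]
  exact Real.rpow_le_rpow (norm_nonneg _)
    (((T i).le_opNorm _).trans (mul_le_mul_of_nonneg_right (hC i) (norm_nonneg _))) (by simp)

/-- The direct sum `⊕ᵢ Tᵢ` of a bounded family of operators, `(⊕ᵢ Tᵢ) f = (Tᵢ (f i))ᵢ`. -/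
def diag (T : ∀ i, H i →L[ℂ] H i) (C : ℝ) (hC0 : 0 ≤ C) (hC : ∀ i, ‖T i‖ ≤ C) :
    lp H 2 →L[ℂ] lp H 2 :=
  LinearMap.mkContinuous
    { toFun := fun f => ⟨fun i => T i (f i), memℓp_diag T C hC f⟩
      map_add' := fun f g => by ext i; simp; rfl
      map_smul' := fun c f => by ext i; simp } C (fun f => by
      have h2 : (0 : ℝ) < (2 : ℝ≥0∞).toReal := by norm_num
      have hf := (lp.memℓp f).summable h2
      refine lp.norm_le_of_forall_sum_le h2 (by positivity) (fun s => ?_)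
      rw [Real.mul_rpow hC0 (norm_nonneg _)]
      refine (Finset.sum_le_sum (g := fun i => C ^ (2 : ℝ≥0∞).toReal *
        ‖f i‖ ^ (2 : ℝ≥0∞).toReal) (fun i _ => ?_)).trans ?_
      · rw [← Real.mul_rpow hC0 (norm_nonneg _)]
        exact Real.rpow_le_rpow (norm_nonneg _)
          (((T i).le_opNorm _).trans (mul_le_mul_of_nonneg_right (hC i) (norm_nonneg _))) h2.le
      · rw [← Finset.mul_sum]
        exact mul_le_mul_of_nonneg_left (lp.sum_rpow_le_norm_rpow h2 f s) (by positivity))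

@[simp]
theorem diag_apply (T : ∀ i, H i →L[ℂ] H i) (C : ℝ) (hC0 : 0 ≤ C) (hC : ∀ i, ‖T i‖ ≤ C)
    (f : lp H 2) (i : ι) : diag T C hC0 hC f i = T i (f i) := rfl

end L2Sum

/-! ### The reduced crossed product -/

namespace CrossedProduct

variable {G A H : Type*} [Group G] [NonUnitalCStarAlgebra A]
  [NormedAddCommGroup H] [InnerProductSpace ℂ H] [CompleteSpace H]

/-- The Hilbert space `ℓ²(G, H)`. -/
abbrev L2 (G H : Type*) [NormedAddCommGroup H] [InnerProductSpace ℂ H] : Type _ :=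
  lp (fun _ : G => H) 2

/-- The left translation `(λ_s ξ)(t) = ξ(s⁻¹ t)` on `ℓ²(G, H)`. -/
def translation (s : G) : L2 G H →L[ℂ] L2 G H :=
  LinearMap.mkContinuous
    { toFun := fun f => ⟨fun t => f (s⁻¹ * t), memℓp_gen
        (((Equiv.mulLeft s⁻¹).summable_iff (f := fun t => ‖f t‖ ^ (2 : ℝ≥0∞).toReal)).2
          ((lp.memℓp f).summable (by norm_num)))⟩
      map_add' := fun f g => by ext i; simp; rfl
      map_smul' := fun c f => by ext i; simp } 1 (fun f => by
      have h2 : (0 : ℝ) < (2 : ℝ≥0∞).toReal := by norm_num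
      rw [one_mul]
      refine lp.norm_le_of_tsum_le h2 (norm_nonneg _) ?_
      rw [lp.norm_rpow_eq_tsum h2 f]
      exact ((Equiv.mulLeft s⁻¹).tsum_eq (fun t => ‖f t‖ ^ (2 : ℝ≥0∞).toReal)).le)

@[simp]
theorem translation_apply (s : G) (f : L2 G H) (t : G) :
    translation s f t = f (s⁻¹ * t) := rfl

theorem translation_mul (s t : G) :
    translation (H := H) (s * t) = translation s * translation t := by
  ext f r
  simp [mul_assoc]

theorem translation_one : translation (H := H) (1 : G) = 1 := by
  ext f r
  simp

theorem star_translation (s : G) : star (translation (H := H) s) = translation s⁻¹ := by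
  symm
  rw [ContinuousLinearMap.star_eq_adjoint, ContinuousLinearMap.eq_adjoint_iff]
  intro f g
  rw [lp.inner_eq_tsum, lp.inner_eq_tsum, ← (Equiv.mulLeft s⁻¹).tsum_eq]
  simp

/-- The representation `(π̃(a) ξ)(t) = π(t⁻¹.a) ξ(t)` of `A` on `ℓ²(G, H)`. -/
def regularRep (α : G →* (A ≃⋆ₐ[ℂ] A)) (π : A →⋆ₙₐ[ℂ] (H →L[ℂ] H)) :
    A →⋆ₙₐ[ℂ] (L2 G H →L[ℂ] L2 G H) where
  toFun a := L2Sum.diag (fun t => π (α t⁻¹ a)) ‖a‖ (norm_nonneg a) (fun t =>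
    (NonUnitalStarAlgHom.norm_apply_le π _).trans
      (NonUnitalStarAlgHom.norm_apply_le (α t⁻¹) a))
  map_smul' c a := by ext f t; simp
  map_zero' := by ext f t; simp
  map_add' a b := by ext f t; simp
  map_mul' a b := by ext f t; simp
  map_star' a := by
    rw [ContinuousLinearMap.star_eq_adjoint, ContinuousLinearMap.eq_adjoint_iff]
    intro f g
    rw [lp.inner_eq_tsum, lp.inner_eq_tsum]
    refine tsum_congr fun t => ?_
    simp only [L2Sum.diag_apply, map_star, ContinuousLinearMap.star_eq_adjoint,
      ContinuousLinearMap.adjoint_inner_left]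

variable (α : G →* (A ≃⋆ₐ[ℂ] A)) (π : A →⋆ₙₐ[ℂ] (H →L[ℂ] H))

@[simp]
theorem regularRep_apply (a : A) (f : L2 G H) (t : G) :
    regularRep α π a f t = π (α t⁻¹ a) (f t) := rfl

/-- The covariance relation `λ_s π̃(a) = π̃(s.a) λ_s`. -/
theorem translation_mul_regularRep (s : G) (a : A) :
    translation s * regularRep α π a = regularRep α π (α s a) * translation s := by
  ext f t
  simp only [mul_apply_eq_comp, translation_apply, regularRep_apply, mul_inv_rev,
    inv_inv, map_mul, StarAlgEquiv.aut_mul]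
  rfl

/-- The operators `π̃(a) λ_s`, for `a ∈ A` and `s ∈ G`. -/
def generators : Set (L2 G H →L[ℂ] L2 G H) :=
  Set.range fun p : A × G => regularRep α π p.1 * translation p.2

theorem generators_mul {x y : L2 G H →L[ℂ] L2 G H} (hx : x ∈ generators α π)
    (hy : y ∈ generators α π) : x * y ∈ generators α π := by
  obtain ⟨⟨a, s⟩, rfl⟩ := hx
  obtain ⟨⟨b, t⟩, rfl⟩ := hy
  refine ⟨(a * α s b, s * t), ?_⟩
  simp only [map_mul, translation_mul]
  rw [mul_assoc (regularRep α π a), mul_assoc (regularRep α π a),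
    ← mul_assoc (translation s), translation_mul_regularRep, mul_assoc]

theorem generators_star {x : L2 G H →L[ℂ] L2 G H} (hx : x ∈ generators α π) :
    star x ∈ generators α π := by
  obtain ⟨⟨a, s⟩, rfl⟩ := hx
  refine ⟨(α s⁻¹ (star a), s⁻¹), ?_⟩
  simp only [star_mul, star_translation]
  rw [← translation_mul_regularRep, map_star]

/-- The image of `C_c(G, A)` in `B(ℓ²(G, H))`, that is, the `*`-algebra of finite sums
`∑ₜ π̃(aₜ) λₜ`. -/
def finiteSums : NonUnitalStarSubalgebra ℂ (L2 G H →L[ℂ] L2 G H) where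
  toSubmodule := Submodule.span ℂ (generators α π)
  mul_mem' := by
    intro x y hx hy
    refine Submodule.span_induction₂ (p := fun x y _ _ => x * y ∈ Submodule.span ℂ
      (generators α π)) ?_ ?_ ?_ ?_ ?_ ?_ ?_ hx hy
    · exact fun x y hx hy => Submodule.subset_span (generators_mul α π hx hy)
    · intro y _; simp
    · intro x _; simp
    · intro x y z _ _ _ h1 h2; rw [add_mul]; exact Submodule.add_mem _ h1 h2
    · intro x y z _ _ _ h1 h2; rw [mul_add]; exact Submodule.add_mem _ h1 h2
    · intro r x y _ _ h; rw [smul_mul_assoc]; exact Submodule.smul_mem _ r h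
    · intro r x y _ _ h; rw [mul_smul_comm]; exact Submodule.smul_mem _ r h
  star_mem' := by
    intro x hx
    refine Submodule.span_induction (p := fun x _ => star x ∈ Submodule.span ℂ
      (generators α π)) ?_ ?_ ?_ ?_ hx
    · exact fun x hx => Submodule.subset_span (generators_star α π hx)
    · simp
    · intro x y _ _ h1 h2; rw [star_add]; exact Submodule.add_mem _ h1 h2
    · intro r x _ h; rw [star_smul]; exact Submodule.smul_mem _ _ h

/-- The reduced crossed product `A ⋊_r G` of `A` by an action `α` of the discrete group `G`,
formed with respect to a representation `π` of `A` on a Hilbert space `H`: the norm closure of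
`C_c(G, A)` in `B(ℓ²(G, H))`. When `π` is faithful this is the reduced crossed product (up to
isomorphism, it does not depend on the choice of the faithful representation). -/
def Reduced : Type _ := (finiteSums α π).topologicalClosure

instance : NonUnitalCStarAlgebra (Reduced α π) :=
  NonUnitalStarSubalgebra.nonUnitalCStarAlgebra (finiteSums α π).topologicalClosure
    (h_closed := NonUnitalStarSubalgebra.isClosed_topologicalClosure _)

/-- The standard order of the C⋆-algebra `A ⋊_r G`. -/
instance : PartialOrder (Reduced α π) := CStarAlgebra.spectralOrder (Reduced α π)

instance : StarOrderedRing (Reduced α π) := CStarAlgebra.spectralOrderedRing (Reduced α π)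

namespace Reduced

/-- The inclusion of `A ⋊_r G` in `B(ℓ²(G, H))`. -/
def toOperator : Reduced α π →⋆ₙₐ[ℂ] (L2 G H →L[ℂ] L2 G H) :=
  NonUnitalStarSubalgebraClass.subtype (finiteSums α π).topologicalClosure

theorem toOperator_injective : Function.Injective (toOperator α π) := Subtype.val_injective

theorem toOperator_mem (x : Reduced α π) :
    toOperator α π x ∈ closure (Submodule.span ℂ (generators α π) : Set _) := x.2

/-- The element `a u_s` of `A ⋊_r G`. -/
def single (s : G) (a : A) : Reduced α π :=
  ⟨regularRep α π a * translation s, subset_closure (Submodule.subset_span ⟨(a, s), rfl⟩)⟩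

theorem toOperator_single (s : G) (a : A) :
    toOperator α π (single α π s a) = regularRep α π a * translation s := rfl

/-- The canonical inclusion of `A` in `A ⋊_r G`, `a ↦ a u_e`. -/
def incl : A →⋆ₙₐ[ℂ] Reduced α π where
  toFun a := single α π 1 a
  map_smul' c a := toOperator_injective α π (by simp [toOperator_single, translation_one])
  map_zero' := toOperator_injective α π (by simp [toOperator_single])
  map_add' a b := toOperator_injective α π (by simp [toOperator_single, translation_one])
  map_mul' a b := toOperator_injective α π (by simp [toOperator_single, translation_one])
  map_star' a := toOperator_injective α π (by
    rw [map_star (toOperator α π)]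
    simp only [toOperator_single, translation_one, mul_one, map_star])

theorem incl_nonneg [PartialOrder A] [StarOrderedRing A] {a : A} (ha : 0 ≤ a) :
    0 ≤ incl α π a := by
  obtain ⟨b, rfl⟩ := CStarAlgebra.nonneg_iff_eq_star_mul_self.1 ha
  rw [map_mul, map_star]
  exact star_mul_self_nonneg _

end Reduced

/-- The embedding of `H` in `ℓ²(G, H)` at the neutral element. -/
def embedOne (G H : Type*) [Group G] [NormedAddCommGroup H] [InnerProductSpace ℂ H] :
    H →L[ℂ] L2 G H :=
  letI := Classical.decEq G
  lp.singleContinuousLinearMap ℂ (fun _ : G => H) 2 1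

theorem embedOne_apply [DecidableEq G] (ξ : H) (t : G) :
    embedOne G H ξ t = if t = 1 then ξ else 0 := by
  simp only [embedOne, lp.singleContinuousLinearMap_apply]
  split_ifs with h
  · subst h; simp
  · exact @lp.single_apply_ne _ (fun _ : G => H) _ (Classical.decEq G) 2 1 ξ _ h

theorem norm_embedOne_le : ‖embedOne G H‖ ≤ 1 := by
  let _ := Classical.decEq G
  refine ContinuousLinearMap.opNorm_le_bound _ zero_le_one fun ξ => ?_
  rw [one_mul]
  exact (lp.norm_single (E := fun _ : G => H) (p := 2) (by norm_num) 1 ξ).le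

theorem inner_embedOne_left (ξ : H) (f : L2 G H) : ⟪embedOne G H ξ, f⟫_ℂ = ⟪ξ, f 1⟫_ℂ :=
  let _ := Classical.decEq G
  lp.inner_single_left (G := fun _ : G => H) 1 ξ f

theorem adjoint_embedOne_apply (f : L2 G H) :
    ContinuousLinearMap.adjoint (embedOne G H) f = f 1 := by
  refine ext_inner_left ℂ fun ξ => ?_
  rw [ContinuousLinearMap.adjoint_inner_right, inner_embedOne_left]

/-- The compression `x ↦ V* x V` of operators on `ℓ²(G, H)` to the copy of `H` at the neutral
element. -/
def compression (G H : Type*) [Group G] [NormedAddCommGroup H] [InnerProductSpace ℂ H]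
    [CompleteSpace H] : (L2 G H →L[ℂ] L2 G H) →L[ℂ] (H →L[ℂ] H) :=
  LinearMap.mkContinuous
    { toFun := fun x => (ContinuousLinearMap.adjoint (embedOne G H)).comp (x.comp (embedOne G H))
      map_add' := fun x y => by ext ξ; simp
      map_smul' := fun c x => by ext ξ; simp } 1 (fun x => by
      have h1 : ‖embedOne G H‖ ≤ 1 := norm_embedOne_le
      have h2 : ‖ContinuousLinearMap.adjoint (embedOne G H)‖ ≤ 1 := by
        rw [LinearIsometryEquiv.norm_map]; exact h1
      calc _ ≤ ‖ContinuousLinearMap.adjoint (embedOne G H)‖ * (‖x‖ * ‖embedOne G H‖) :=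
            (ContinuousLinearMap.opNorm_comp_le _ _).trans
              (mul_le_mul_of_nonneg_left (ContinuousLinearMap.opNorm_comp_le _ _)
                (norm_nonneg _))
        _ ≤ 1 * (‖x‖ * 1) := by gcongr
        _ = 1 * ‖x‖ := by ring)

theorem compression_eq (x : L2 G H →L[ℂ] L2 G H) : compression G H x =
    (ContinuousLinearMap.adjoint (embedOne G H)).comp (x.comp (embedOne G H)) := rfl

theorem compression_apply (x : L2 G H →L[ℂ] L2 G H) (ξ : H) :
    compression G H x ξ = x (embedOne G H ξ) 1 := by
  rw [compression_eq]
  exact adjoint_embedOne_apply _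

theorem norm_compression_le (x : L2 G H →L[ℂ] L2 G H) : ‖compression G H x‖ ≤ ‖x‖ := by
  have := (compression G H).le_of_opNorm_le
    (LinearMap.mkContinuous_norm_le _ zero_le_one _) x
  simpa using this

theorem compression_generator [DecidableEq G] (a : A) (s : G) :
    compression G H (regularRep α π a * translation s) = if s = 1 then π a else 0 := by
  ext ξ
  rw [compression_apply]
  simp only [mul_apply_eq_comp, regularRep_apply, translation_apply, embedOne_apply]
  by_cases h : s = 1 <;> simp [h]

theorem isClosed_range {π : A →⋆ₙₐ[ℂ] (H →L[ℂ] H)} (hπ : Function.Injective π) :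
    IsClosed (Set.range π) :=
  (NonUnitalStarAlgHom.isometry π hπ).isClosedEmbedding.isClosed_range

variable {π} in
theorem exists_compression_eq (hπ : Function.Injective π) (x : Reduced α π) :
    ∃ a : A, π a = compression G H (Reduced.toOperator α π x) := by
  classical
  have hsub : closure (Submodule.span ℂ (generators α π) : Set (L2 G H →L[ℂ] L2 G H)) ⊆
      compression G H ⁻¹' Set.range π := by
    refine closure_minimal ?_ ((isClosed_range hπ).preimage (compression G H).continuous)
    intro y hy
    refine Submodule.span_induction (p := fun y _ => y ∈ compression G H ⁻¹' Set.range π)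
      ?_ ?_ ?_ ?_ hy
    · rintro _ ⟨⟨a, s⟩, rfl⟩
      refine ⟨if s = 1 then a else 0, ?_⟩
      rw [compression_generator]
      split_ifs <;> simp
    · exact ⟨0, by simp⟩
    · rintro y z _ _ ⟨a, ha⟩ ⟨b, hb⟩
      exact ⟨a + b, by rw [map_add, map_add, ha, hb]⟩
    · rintro c y _ ⟨a, ha⟩
      exact ⟨c • a, by rw [map_smul, map_smul, ha]⟩
  exact hsub (Reduced.toOperator_mem α π x)

variable {π}

/-- The canonical conditional expectation `E : A ⋊_r G → A`. It is the map with
`π (E x) = V* x V`, where `V : H → ℓ²(G, H)` is the embedding at the neutral element. -/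
def condExp (hπ : Function.Injective π) : Reduced α π →L[ℂ] A :=
  LinearMap.mkContinuous
    { toFun := fun x => (exists_compression_eq α hπ x).choose
      map_add' := fun x y => hπ (by
        rw [(exists_compression_eq α hπ (x + y)).choose_spec, map_add, map_add, map_add,
          (exists_compression_eq α hπ x).choose_spec, (exists_compression_eq α hπ y).choose_spec])
      map_smul' := fun c x => hπ (by
        rw [(exists_compression_eq α hπ (c • x)).choose_spec, map_smul, map_smul,
          RingHom.id_apply, map_smul, (exists_compression_eq α hπ x).choose_spec]) } 1 (fun x => by
      rw [one_mul, ← NonUnitalStarAlgHom.norm_map π hπ]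
      change ‖π (exists_compression_eq α hπ x).choose‖ ≤ _
      rw [(exists_compression_eq α hπ x).choose_spec]
      exact norm_compression_le _)

theorem map_condExp (hπ : Function.Injective π) (x : Reduced α π) :
    π (condExp α hπ x) = compression G H (Reduced.toOperator α π x) :=
  (exists_compression_eq α hπ x).choose_spec

/-- `E(a u_s)` is `a` if `s = e` and `0` otherwise. Hence `E (∑ₜ aₜ uₜ) = a_e` on `C_c(G, A)`. -/
theorem condExp_single [DecidableEq G] (hπ : Function.Injective π) (s : G) (a : A) :
    condExp α hπ (Reduced.single α π s a) = if s = 1 then a else 0 := by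
  refine hπ ?_
  rw [map_condExp, Reduced.toOperator_single, compression_generator]
  split_ifs <;> simp

variable [PartialOrder A] [StarOrderedRing A]

/-- A faithful representation reflects positivity. -/
theorem nonneg_of_map_nonneg (hπ : Function.Injective π) {a : A} (ha : 0 ≤ π a) : 0 ≤ a := by
  have hsa : IsSelfAdjoint a := hπ (by rw [map_star]; exact IsSelfAdjoint.of_nonneg ha)
  have h := (CFC.posPart_negPart_unique (a := π a) (b := π a⁺) (c := π a⁻)
    (by rw [← map_sub, CFC.posPart_sub_negPart a hsa])
    (by rw [← map_mul, CFC.posPart_mul_negPart, map_zero])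
    (map_nonneg π (CFC.posPart_nonneg a)) (map_nonneg π (CFC.negPart_nonneg a))).2
  rw [(CFC.negPart_eq_zero_iff (π a) (IsSelfAdjoint.of_nonneg ha)).2 ha,
    eq_comm, map_eq_zero_iff π hπ] at h
  exact (CFC.negPart_eq_zero_iff a hsa).1 h

/-- The conditional expectation is positive. -/
theorem condExp_nonneg (hπ : Function.Injective π) {x : Reduced α π} (hx : 0 ≤ x) :
    0 ≤ condExp α hπ x := by
  obtain ⟨y, rfl⟩ := CStarAlgebra.nonneg_iff_eq_star_mul_self.1 hx
  refine nonneg_of_map_nonneg hπ ?_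
  rw [map_condExp, map_mul, map_star, compression_eq, ContinuousLinearMap.star_eq_adjoint]
  rw [ContinuousLinearMap.nonneg_iff_isPositive]
  have h := ContinuousLinearMap.isPositive_adjoint_comp_self
    ((Reduced.toOperator α π y).comp (embedOne G H))
  rwa [ContinuousLinearMap.adjoint_comp] at h

end CrossedProduct

/-! ### Existence of faithful representations -/

section GelfandNaimark

open scoped ComplexOrder

variable {A : Type*} [NonUnitalCStarAlgebra A] [PartialOrder A] [StarOrderedRing A]

/-- A nonzero positive element is detected by a positive linear functional. -/
theorem exists_positiveLinearMap_ne_zero {a : A} (ha : 0 ≤ a) (ha0 : a ≠ 0) :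
    ∃ φ : A →ₚ[ℂ] ℂ, φ a ≠ 0 := by
  let C : ProperCone ℝ A :=
    { carrier := {x | 0 ≤ x}
      add_mem' := fun hx hy => add_nonneg hx hy
      zero_mem' := le_refl (0 : A)
      smul_mem' := fun c x hx => smul_nonneg (α := ℝ) c.2 hx
      isClosed' := CStarAlgebra.isClosed_nonneg }
  have hna : -a ∉ C := fun h => ha0 (le_antisymm (neg_nonneg.1 h) ha)
  obtain ⟨f, hf, hfa⟩ := C.hyperplane_separation_point hna
  let fr : A →ₗ[ℝ] ℝ :=
    f.toLinearMap ∘ₗ (selfAdjoint.submodule ℝ A).subtype ∘ₗ (realPart : A →ₗ[ℝ] selfAdjoint A)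
  have key : ∀ x : A, 0 ≤ x → Module.Dual.extendRCLike (𝕜 := ℂ) fr x = (f x : ℂ) := by
    intro x hx
    have hsa : IsSelfAdjoint x := IsSelfAdjoint.of_nonneg hx
    have h1 : fr x = f x := by
      change f (realPart x : A) = f x
      rw [hsa.coe_realPart]
    have h2 : fr (Complex.I • x) = 0 := by
      change f (realPart (Complex.I • x) : A) = 0
      rw [realPart_I_smul, hsa.imaginaryPart]
      simp
    rw [Module.Dual.extendRCLike_apply]
    simp [h1, h2]
  refine ⟨PositiveLinearMap.mk₀ (Module.Dual.extendRCLike (𝕜 := ℂ) fr) fun x hx => ?_, ?_⟩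
  · rw [key x hx]
    exact Complex.zero_le_real.2 (hf x hx)
  · change Module.Dual.extendRCLike (𝕜 := ℂ) fr a ≠ 0
    rw [key a ha]
    rw [map_neg] at hfa
    exact Complex.ofReal_ne_zero.2 (by linarith)

/-- The universal representation of a C⋆-algebra: the direct sum of the GNS representations of
all positive linear functionals. -/
def universalRep (A : Type*) [NonUnitalCStarAlgebra A] [PartialOrder A] [StarOrderedRing A] :
    A →⋆ₙₐ[ℂ] (lp (fun φ : A →ₚ[ℂ] ℂ => φ.GNS) 2 →L[ℂ] lp (fun φ : A →ₚ[ℂ] ℂ => φ.GNS) 2) where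
  toFun a := L2Sum.diag (fun φ : A →ₚ[ℂ] ℂ => φ.gnsNonUnitalStarAlgHom a) ‖a‖ (norm_nonneg a)
    (fun φ => NonUnitalStarAlgHom.norm_apply_le φ.gnsNonUnitalStarAlgHom a)
  map_smul' c a := by ext f φ; simp only [L2Sum.diag_apply, map_smul]; rfl
  map_zero' := by ext f φ; simp only [L2Sum.diag_apply, map_zero]; rfl
  map_add' a b := by ext f φ; simp only [L2Sum.diag_apply, map_add]; rfl
  map_mul' a b := by ext f φ; simp only [L2Sum.diag_apply, map_mul]; rfl
  map_star' a := by
    rw [ContinuousLinearMap.star_eq_adjoint, ContinuousLinearMap.eq_adjoint_iff]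
    intro f g
    rw [lp.inner_eq_tsum, lp.inner_eq_tsum]
    refine tsum_congr fun φ => ?_
    simp only [L2Sum.diag_apply, map_star, ContinuousLinearMap.star_eq_adjoint,
      ContinuousLinearMap.adjoint_inner_left]

/-- The universal representation is faithful. Thus every C⋆-algebra has a faithful representation,
and so every action on a C⋆-algebra has a reduced crossed product in the above sense. -/
theorem universalRep_injective : Function.Injective (universalRep A) := by
  classical
  rw [injective_iff_map_eq_zero]
  intro a ha
  by_contra ha0
  have h1 : a * star a ≠ 0 := fun h => ha0 (CStarRing.mul_star_self_eq_zero_iff a |>.1 h)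
  have h2 : star (a * star a) * (a * star a) ≠ 0 :=
    fun h => h1 (CStarRing.star_mul_self_eq_zero_iff _ |>.1 h)
  obtain ⟨φ, hφ⟩ := exists_positiveLinearMap_ne_zero (star_mul_self_nonneg (a * star a)) h2
  have h3 : φ.gnsNonUnitalStarAlgHom a (φ.toPreGNS (star a)) = 0 := by
    have h := congrArg (fun T => T (lp.single (E := fun φ : A →ₚ[ℂ] ℂ => φ.GNS) 2 φ
      ((φ.toPreGNS (star a) : φ.PreGNS) : φ.GNS)) φ) ha
    change φ.gnsNonUnitalStarAlgHom a (lp.single (E := fun φ : A →ₚ[ℂ] ℂ => φ.GNS) 2 φ _ φ) = 0 at h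
    rwa [lp.single_apply_self] at h
  rw [PositiveLinearMap.gnsNonUnitalStarAlgHom_apply_coe] at h3
  have h4 := congrArg norm h3
  rw [UniformSpace.Completion.norm_coe, norm_zero] at h4
  have h5 := φ.preGNS_norm_sq (φ.leftMulMapPreGNS a (φ.toPreGNS (star a)))
  rw [h4] at h5
  apply hφ
  simpa using h5.symm

end GelfandNaimark

/-! ### Tracial weights -/

/-- A tracial weight on a C⋆-algebra `A`: a map `φ : A⁺ → [0, ∞]` with
`φ(s a + t b) = s φ(a) + t φ(b)` and `φ(x* x) = φ(x x*)` (with `0 · ∞ = 0`). -/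
structure IsTracialWeight {A : Type*} [NonUnitalCStarAlgebra A] [PartialOrder A]
    [StarOrderedRing A] (φ : {a : A // 0 ≤ a} → ℝ≥0∞) : Prop where
  map_smul_add_smul : ∀ (s t : ℝ≥0) (a b : {a : A // 0 ≤ a}),
    φ ⟨s • (a : A) + t • (b : A), add_nonneg (smul_nonneg s.2 a.2) (smul_nonneg t.2 b.2)⟩ =
      s * φ a + t * φ b
  map_star_mul_self : ∀ x : A,
    φ ⟨star x * x, star_mul_self_nonneg x⟩ = φ ⟨x * star x, mul_star_self_nonneg x⟩

/-- `φ : A⁺ → [0, ∞]` is invariant under the action `α`, i.e. `φ(t.a) = φ(a)`. -/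
def IsInvariantWeight {G A : Type*} [Group G] [NonUnitalCStarAlgebra A] [PartialOrder A]
    [StarOrderedRing A] (α : G →* (A ≃⋆ₐ[ℂ] A)) (φ : {a : A // 0 ≤ a} → ℝ≥0∞) : Prop :=
  ∀ (t : G) (a : {a : A // 0 ≤ a}), φ ⟨α t a, map_nonneg (α t) a.2⟩ = φ a

/-- The map `φ₀ ∘ E : (A ⋊_r G)⁺ → [0, ∞]`, for `φ₀ : A⁺ → [0, ∞]`. -/
def CrossedProduct.compCondExp {G A H : Type*} [Group G] [NonUnitalCStarAlgebra A]
    [PartialOrder A] [StarOrderedRing A] [NormedAddCommGroup H] [InnerProductSpace ℂ H]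
    [CompleteSpace H] (α : G →* (A ≃⋆ₐ[ℂ] A)) {π : A →⋆ₙₐ[ℂ] (H →L[ℂ] H)}
    (hπ : Function.Injective π) (φ₀ : {a : A // 0 ≤ a} → ℝ≥0∞) :
    {x : Reduced α π // 0 ≤ x} → ℝ≥0∞ :=
  fun x => φ₀ ⟨condExp α hπ x, condExp_nonneg α hπ x.2⟩

end

open scoped ENNReal NNReal InnerProductSpace

/-! ### Lower semicontinuous tracial weights -/

namespace IsTracialWeight

variable {A : Type*} [NonUnitalCStarAlgebra A] [PartialOrder A] [StarOrderedRing A]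
  {φ : {a : A // 0 ≤ a} → ℝ≥0∞}

/-! Linearity, lower semicontinuity and the extension property come from `E` being linear, positive
and continuous with `E(a u_e) = a`. Only traciality needs an argument. Put `c_t(x) = E(x u_t)`. The
expansion `E(x x*) = ∑ₜ c_t(x) c_t(x)*` converges in norm (`hasSum_coeff_mul_star`): under `π`, the
remainder over a finite set `F` is `T* T` with `T = Q_F x* V`, where `V` embeds `H` at the neutral
element and `Q_F` cuts away the coordinates in `F`; and `‖T‖ → 0` by density of finite sums
(`tendsto_offProj`). Lower semicontinuity makes `φ₀` additive along such sums
(`IsTracialWeight.map_hasSum`), so `φ(x x*) = ∑ₜ φ₀(c_t(x) c_t(x)*)`. Equivariance of `E` gives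
`c_{t⁻¹}(x*) = t.c_t(x)*` (`coeff_star`). Hence invariance and traciality of `φ₀` match the series
for `x* x` with that for `x x*`, term by term after `t ↦ t⁻¹`. -/

theorem map_add (hφ : IsTracialWeight φ) (a b : {a : A // 0 ≤ a}) :
    φ ⟨a + b, add_nonneg a.2 b.2⟩ = φ a + φ b := by
  simpa using hφ.map_smul_add_smul 1 1 a b

theorem map_zero (hφ : IsTracialWeight φ) : φ ⟨0, le_rfl⟩ = 0 := by
  simpa using hφ.map_smul_add_smul 0 0 ⟨0, le_rfl⟩ ⟨0, le_rfl⟩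

theorem monotone (hφ : IsTracialWeight φ) : Monotone φ := by
  rintro ⟨a, ha⟩ ⟨b, hb⟩ (hab : a ≤ b)
  have h := hφ.map_add ⟨a, ha⟩ ⟨b - a, sub_nonneg.2 hab⟩
  simp only [add_sub_cancel] at h
  exact h ▸ le_self_add

theorem map_sum {ι : Type*} (hφ : IsTracialWeight φ) (f : ι → {a : A // 0 ≤ a}) (s : Finset ι) :
    φ ⟨∑ i ∈ s, (f i : A), Finset.sum_nonneg fun i _ => (f i).2⟩ = ∑ i ∈ s, φ (f i) := by
  classical
  induction s using Finset.induction_on with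
  | empty => simpa using hφ.map_zero
  | insert i s hi ih =>
    simp only [Finset.sum_insert hi]
    rw [← ih]
    exact hφ.map_add (f i) ⟨∑ i ∈ s, (f i : A), Finset.sum_nonneg fun i _ => (f i).2⟩

/-- A lower semicontinuous tracial weight is countably additive along norm convergent sums of
positive elements. -/
theorem map_hasSum {ι : Type*} (hφ : IsTracialWeight φ) (hlsc : LowerSemicontinuous φ)
    (f : ι → {a : A // 0 ≤ a}) (a : {a : A // 0 ≤ a}) (h : HasSum (fun i => (f i : A)) a) :
    φ a = ∑' i, φ (f i) := by
  apply le_antisymm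
  · refine le_of_forall_lt fun y hy => ?_
    -- Lower semicontinuity at `a`: any `y < φ a` is already exceeded by `φ` at some finite partial
    -- sum.
    have ht : Filter.Tendsto (fun s : Finset ι =>
        (⟨∑ i ∈ s, (f i : A), Finset.sum_nonneg fun i _ => (f i).2⟩ : {a : A // 0 ≤ a}))
        Filter.atTop (nhds a) := tendsto_subtype_rng.2 h
    obtain ⟨s, hs⟩ := (ht.eventually (hlsc a y hy)).exists
    rw [hφ.map_sum] at hs
    exact hs.trans_le (ENNReal.sum_le_tsum s)
  · rw [ENNReal.tsum_eq_iSup_sum]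
    -- Partial sums of positive terms lie below `a`, so monotonicity is enough here.
    refine iSup_le fun s => ?_
    rw [← hφ.map_sum]
    exact hφ.monotone (show ∑ i ∈ s, (f i : A) ≤ a from
      sum_le_hasSum s (fun i _ => (f i).2) h)

end IsTracialWeight

/-! ### Fourier coefficients in the reduced crossed product -/

namespace CrossedProduct

variable {G H : Type*} [NormedAddCommGroup H] [InnerProductSpace ℂ H] [CompleteSpace H]

/-! ### Cutting off finitely many coordinates -/

/-- The projection of `ℓ²(G, H)` onto the vectors vanishing on `F`. -/
noncomputable def offProj (H : Type*) [NormedAddCommGroup H] [InnerProductSpace ℂ H]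
    [CompleteSpace H] (F : Finset G) : L2 G H →L[ℂ] L2 G H :=
  letI := Classical.decEq G
  L2Sum.diag (fun t => if t ∈ F then 0 else 1) 1 zero_le_one (fun t => by
    split_ifs
    · simp
    · exact ContinuousLinearMap.norm_id_le)

theorem offProj_apply [DecidableEq G] (F : Finset G) (f : L2 G H) (t : G) :
    offProj H F f t = if t ∈ F then 0 else f t := by
  simp only [offProj, L2Sum.diag_apply]
  split_ifs <;> simp

theorem norm_offProj_le (F : Finset G) : ‖offProj H F‖ ≤ 1 := by
  unfold offProj L2Sum.diag
  exact LinearMap.mkContinuous_norm_le _ zero_le_one _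

theorem offProj_mul_self (F : Finset G) : offProj H F * offProj H F = offProj H F := by
  classical
  ext f t
  simp only [mul_apply_eq_comp, offProj_apply]
  split_ifs <;> rfl

/-- Together with idempotence this lets the remainder `X Q_F X*` of the Fourier expansion be written
as `(Q_F X*)* (Q_F X*)`. -/
theorem star_offProj (F : Finset G) : star (offProj H F) = offProj H F := by
  classical
  symm
  rw [ContinuousLinearMap.star_eq_adjoint, ContinuousLinearMap.eq_adjoint_iff]
  intro f g
  rw [lp.inner_eq_tsum, lp.inner_eq_tsum]
  refine tsum_congr fun t => ?_
  simp only [offProj_apply]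
  split_ifs <;> simp

variable {A : Type*} [Group G] [NonUnitalCStarAlgebra A]

/-- The projection onto the coordinates in `F` is a sum of translates of the projection onto the
coordinate at the neutral element. -/
theorem sum_translation_embedOne (F : Finset G) :
    ∑ t ∈ F, (translation t).comp ((embedOne G H).comp
      ((ContinuousLinearMap.adjoint (embedOne G H)).comp (translation t⁻¹))) =
      1 - offProj H F := by
  classical
  ext f r
  -- At coordinate `r` only the summand `t = r` survives, and it contributes `f r`.
  have h (t : G) : t⁻¹ * r = 1 ↔ r = t := by rw [inv_mul_eq_one, eq_comm]
  simp only [sum_apply, lp.coeFn_sum, Finset.sum_apply,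
    ContinuousLinearMap.comp_apply, translation_apply, adjoint_embedOne_apply, embedOne_apply,
    sub_apply, one_apply_eq_self, lp.coeFn_sub, Pi.sub_apply,
    offProj_apply, h, inv_inv, mul_one, Finset.sum_ite_eq]
  split_ifs <;> simp

variable (α : G →* (A ≃⋆ₐ[ℂ] A)) (π : A →⋆ₙₐ[ℂ] (H →L[ℂ] H))

/-- For `x` in `A ⋊_r G`, the operators `x V` are limits of operators with values in the vectors
of finite support. -/
theorem tendsto_offProj (x : Reduced α π) :
    Filter.Tendsto (fun F : Finset G =>
      ‖(offProj H F).comp ((Reduced.toOperator α π x).comp (embedOne G H))‖)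
      Filter.atTop (nhds 0) := by
  classical
  -- For finite sums the cut-off is eventually exactly zero: `π̃(a) λ_s V ξ` is supported at the
  -- single point `s`.
  have key : ∀ y ∈ Submodule.span ℂ (generators α π), ∀ᶠ F : Finset G in Filter.atTop,
      (offProj H F).comp (y.comp (embedOne G H)) = 0 := by
    intro y hy
    induction hy using Submodule.span_induction with
    | mem y hy =>
      obtain ⟨⟨a, s⟩, rfl⟩ := hy
      filter_upwards [Filter.eventually_ge_atTop {s}] with F hF
      ext ξ t
      simp only [ContinuousLinearMap.comp_apply, mul_apply_eq_comp, offProj_apply,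
        regularRep_apply, translation_apply, embedOne_apply]
      split_ifs with h1 h2
      · simp
      · exact absurd (hF (Finset.mem_singleton.2 (inv_mul_eq_one.1 h2).symm)) h1
      · simp
    | zero => simp
    | add y z _ _ h1 h2 =>
      filter_upwards [h1, h2] with F h1 h2
      rw [ContinuousLinearMap.add_comp, ContinuousLinearMap.comp_add, h1, h2, add_zero]
    | smul c y _ h =>
      filter_upwards [h] with F h
      rw [ContinuousLinearMap.smul_comp, ContinuousLinearMap.comp_smul, h, smul_zero]
  rw [Metric.tendsto_nhds]
  intro ε hε
  obtain ⟨y, hy, hxy⟩ := Metric.mem_closure_iff.1 (Reduced.toOperator_mem α π x) ε hε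
  filter_upwards [key y hy] with F hF
  rw [dist_zero_right]
  refine (abs_of_nonneg (norm_nonneg
    ((offProj H F).comp ((Reduced.toOperator α π x).comp (embedOne G H))))).trans_lt ?_
  set X := Reduced.toOperator α π x
  -- As `Q_F y V = 0`, only the error `X - y` matters, and its bound is uniform in `F`.
  have hX : (offProj H F).comp (X.comp (embedOne G H)) =
      (offProj H F).comp ((X - y).comp (embedOne G H)) := by
    rw [ContinuousLinearMap.sub_comp, ContinuousLinearMap.comp_sub, hF, sub_zero]
  rw [hX]
  calc _ ≤ ‖offProj H F‖ * (‖X - y‖ * ‖embedOne G H‖) :=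
        (ContinuousLinearMap.opNorm_comp_le _ _).trans
          (mul_le_mul_of_nonneg_left (ContinuousLinearMap.opNorm_comp_le _ _) (norm_nonneg _))
    _ ≤ 1 * (‖X - y‖ * 1) := by
        gcongr
        · exact norm_offProj_le F
        · exact norm_embedOne_le
    _ = ‖X - y‖ := by ring
    _ < ε := by rwa [← dist_eq_norm]

/-! ### Right translation and equivariance of the expectation -/

/-- When `A` has no unit, `λ_s` need not lie in the crossed product. Still, right multiplication by
it is continuous and permutes the generators, so it preserves their closed span. -/
theorem mul_translation_mem (x : Reduced α π) (s : G) :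
    Reduced.toOperator α π x * translation s ∈ (finiteSums α π).topologicalClosure := by
  refine closure_minimal (t := (fun y => y * translation (H := H) s) ⁻¹'
    (closure (Submodule.span ℂ (generators α π) : Set (L2 G H →L[ℂ] L2 G H)))) ?_
    (isClosed_closure.preimage (by fun_prop)) (Reduced.toOperator_mem α π x)
  intro y hy
  refine subset_closure ?_
  change y * translation s ∈ Submodule.span ℂ (generators α π)
  induction hy using Submodule.span_induction with
  | mem y hy =>
    obtain ⟨⟨a, t⟩, rfl⟩ := hy
    exact Submodule.subset_span ⟨(a, t * s), by simp only [translation_mul, mul_assoc]⟩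
  | zero => simp
  | add y z _ _ h1 h2 => rw [add_mul]; exact Submodule.add_mem _ h1 h2
  | smul c y _ h => rw [smul_mul_assoc]; exact Submodule.smul_mem _ c h

/-- The element `x u_s` of `A ⋊_r G`. -/
noncomputable def Reduced.mulTranslation (x : Reduced α π) (s : G) : Reduced α π :=
  ⟨Reduced.toOperator α π x * translation s, mul_translation_mem α π x s⟩

theorem Reduced.toOperator_mulTranslation (x : Reduced α π) (s : G) :
    toOperator α π (mulTranslation α π x s) = toOperator α π x * translation s := rfl

variable {π}

/-- The translates of the conditional expectation under the action. -/
theorem map_apply_condExp (hπ : Function.Injective π) (x : Reduced α π) (s : G) :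
    π (α s (condExp α hπ x)) =
      compression G H (translation s * Reduced.toOperator α π x * translation s⁻¹) := by
  classical
  -- Both sides are continuous in `x`, so it suffices to compare them on finite sums.
  have hclosed : IsClosed {x : Reduced α π | π (α s (condExp α hπ x)) =
      compression G H (translation s * Reduced.toOperator α π x * translation s⁻¹)} := by
    refine isClosed_eq ?_ ?_
    · exact (NonUnitalStarAlgHom.isometry π hπ).continuous.comp
        ((NonUnitalStarAlgHom.isometry (α s) (α s).injective).continuous.comp
          (condExp α hπ).continuous)
    · have : Continuous (Reduced.toOperator α π) := continuous_subtype_val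
      fun_prop
  have key : ∀ y ∈ Submodule.span ℂ (generators α π), ∃ z : Reduced α π,
      Reduced.toOperator α π z = y ∧ π (α s (condExp α hπ z)) =
        compression G H (translation s * Reduced.toOperator α π z * translation s⁻¹) := by
    intro y hy
    induction hy using Submodule.span_induction with
    | mem y hy =>
      obtain ⟨⟨a, t⟩, rfl⟩ := hy
      refine ⟨Reduced.single α π t a, rfl, ?_⟩
      have h : translation s * (regularRep α π a * translation t) * translation s⁻¹ =
          regularRep α π (α s a) * translation (s * t * s⁻¹) := by
        rw [← mul_assoc, translation_mul_regularRep, translation_mul, translation_mul]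
        simp only [mul_assoc]
      rw [condExp_single, Reduced.toOperator_single, h, compression_generator]
      by_cases ht : t = 1
      · simp [ht]
      · have ht' : s * t * s⁻¹ ≠ 1 := fun h => ht (conj_eq_one_iff.1 h)
        simp [ht, ht']
    | zero => exact ⟨0, map_zero _, by simp⟩
    | add y z _ _ h1 h2 =>
      obtain ⟨y, rfl, hy⟩ := h1
      obtain ⟨z, rfl, hz⟩ := h2
      exact ⟨y + z, map_add _ _ _, by simp only [map_add, mul_add, add_mul, hy, hz]⟩
    | smul c y _ h =>
      obtain ⟨y, rfl, hy⟩ := h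
      exact ⟨c • y, map_smul _ _ _, by
        simp only [map_smul, mul_smul_comm, smul_mul_assoc, hy]⟩
  refine hclosed.closure_subset_iff.2 subset_rfl (closure_subtype.2 ?_)
  refine closure_mono (fun y hy => ?_) (Reduced.toOperator_mem α π x)
  obtain ⟨z, rfl, hz⟩ := key y hy
  exact ⟨z, hz, rfl⟩

/-! ### Fourier coefficients and the expansion of `E(x x*)` -/

/-- The Fourier coefficient `E(x u_t)` of `x` in `A ⋊_r G`. -/
noncomputable def coeff (hπ : Function.Injective π) (x : Reduced α π) (t : G) : A :=
  condExp α hπ (Reduced.mulTranslation α π x t)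

theorem map_coeff (hπ : Function.Injective π) (x : Reduced α π) (t : G) :
    π (coeff α hπ x t) = compression G H (Reduced.toOperator α π x * translation t) :=
  map_condExp α hπ _

theorem star_compression (y : L2 G H →L[ℂ] L2 G H) :
    star (compression G H y) = compression G H (star y) := by
  simp only [compression_eq, ContinuousLinearMap.star_eq_adjoint,
    ContinuousLinearMap.adjoint_comp, ContinuousLinearMap.adjoint_adjoint]
  rfl

/-- Since `E` commutes with the involution, `E(x u_{t⁻¹})* = E(u_t x*)`. Conjugating by `u_{t⁻¹}`
turns `u_t x*` into `x* u_t`, and equivariance of `E` concludes. -/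
theorem coeff_star (hπ : Function.Injective π) (x : Reduced α π) (t : G) :
    coeff α hπ (star x) t = α t⁻¹ (star (coeff α hπ x t⁻¹)) := by
  refine hπ ?_
  have h : star (coeff α hπ x t⁻¹) =
      condExp α hπ (star (Reduced.mulTranslation α π x t⁻¹)) := hπ (by
    rw [map_star, map_coeff, map_condExp, star_compression, map_star (Reduced.toOperator α π),
      Reduced.toOperator_mulTranslation])
  rw [h, map_apply_condExp, map_coeff, map_star (Reduced.toOperator α π),
    map_star (Reduced.toOperator α π), Reduced.toOperator_mulTranslation,
    star_mul, star_translation, ← mul_assoc, ← translation_mul]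
  simp [translation_one]

/-- The Fourier expansion of `E(x x*)`. -/
theorem hasSum_coeff_mul_star (hπ : Function.Injective π) (x : Reduced α π) :
    HasSum (fun t => coeff α hπ x t * star (coeff α hπ x t)) (condExp α hπ (x * star x)) := by
  set X := Reduced.toOperator α π x with hX
  have key (F : Finset G) :
      π (condExp α hπ (x * star x) - ∑ t ∈ F, coeff α hπ x t * star (coeff α hπ x t)) =
        (ContinuousLinearMap.adjoint ((offProj H F).comp ((star X).comp (embedOne G H)))).comp
          ((offProj H F).comp ((star X).comp (embedOne G H))) := by
    -- Each term inserts the projection `λ_t V V* λ_t⁻¹` onto coordinate `t` between `X` and `X*`;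
    -- summed over `F` these give `1 - Q_F`.
    have h1 : ∀ t, π (coeff α hπ x t * star (coeff α hπ x t)) = compression G H
        (X * ((translation t).comp ((embedOne G H).comp
          ((ContinuousLinearMap.adjoint (embedOne G H)).comp (translation t⁻¹)))) * star X) := by
      intro t
      rw [map_mul, map_star, map_coeff, star_compression, star_mul, star_translation]
      rfl
    have h2 : (ContinuousLinearMap.adjoint
        ((offProj H F).comp ((star X).comp (embedOne G H)))).comp
          ((offProj H F).comp ((star X).comp (embedOne G H))) =
        compression G H (X * (star (offProj H F) * offProj H F) * star X) := by
      simp only [ContinuousLinearMap.adjoint_comp, ContinuousLinearMap.star_eq_adjoint,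
        ContinuousLinearMap.adjoint_adjoint, compression_eq]
      rfl
    rw [h2, star_offProj, offProj_mul_self, map_sub, map_condExp, map_mul, map_star, map_sum]
    simp only [h1]
    rw [← map_sum, ← Finset.sum_mul, ← Finset.mul_sum, sum_translation_embedOne, ← map_sub]
    congr 1
    rw [mul_sub, sub_mul, mul_one, ← hX, sub_sub_cancel]
  refine tendsto_iff_norm_sub_tendsto_zero.2 ?_
  -- The square comes from the C⋆-identity `‖T* T‖ = ‖T‖²`, and `star x` from `T = Q_F X* V`.
  have h := (tendsto_offProj α π (star x)).pow 2
  rw [zero_pow two_ne_zero] at h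
  refine h.congr fun F => ?_
  rw [norm_sub_rev, ← NonUnitalStarAlgHom.norm_map π hπ, key,
    ContinuousLinearMap.norm_adjoint_comp_self, map_star, sq]

end CrossedProduct

/-! ### The weight `φ₀ ∘ E` -/

theorem mainTheorem10 {G A H : Type*} [Group G] [Countable G]
    [NonUnitalCStarAlgebra A] [PartialOrder A] [StarOrderedRing A]
    [NormedAddCommGroup H] [InnerProductSpace ℂ H] [CompleteSpace H]
    (α : G →* (A ≃⋆ₐ[ℂ] A))
    (π : A →⋆ₙₐ[ℂ] (H →L[ℂ] H)) (hπ : Function.Injective π)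
    (φ₀ : {a : A // 0 ≤ a} → ℝ≥0∞)
    (hφ₀ : IsTracialWeight φ₀) (hlsc : LowerSemicontinuous φ₀) (hinv : IsInvariantWeight α φ₀) :
    IsTracialWeight (CrossedProduct.compCondExp α hπ φ₀) ∧
      LowerSemicontinuous (CrossedProduct.compCondExp α hπ φ₀) ∧
      ∀ a : {a : A // 0 ≤ a},
        CrossedProduct.compCondExp α hπ φ₀
          ⟨CrossedProduct.Reduced.incl α π a, CrossedProduct.Reduced.incl_nonneg α π a.2⟩ =
            φ₀ a := by
  classical
  refine ⟨⟨fun s t a b => ?_, fun x => ?_⟩, ?_, fun a => ?_⟩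
  · have h := hφ₀.map_smul_add_smul s t
      ⟨_, CrossedProduct.condExp_nonneg α hπ a.2⟩ ⟨_, CrossedProduct.condExp_nonneg α hπ b.2⟩
    refine Eq.trans ?_ h
    refine congrArg φ₀ (Subtype.ext ?_)
    change CrossedProduct.condExp α hπ ((s : ℝ) • (a : CrossedProduct.Reduced α π) +
      (t : ℝ) • (b : CrossedProduct.Reduced α π)) =
        (s : ℝ) • CrossedProduct.condExp α hπ a + (t : ℝ) • CrossedProduct.condExp α hπ b
    -- `E` is bundled as a complex-linear map, so real scalars are first viewed as complex.
    simp only [← Complex.coe_smul, map_add, map_smul]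
  · have key (y : CrossedProduct.Reduced α π) :
        CrossedProduct.compCondExp α hπ φ₀ ⟨y * star y, mul_star_self_nonneg y⟩ =
          ∑' t, φ₀ ⟨_, mul_star_self_nonneg (CrossedProduct.coeff α hπ y t)⟩ :=
      hφ₀.map_hasSum hlsc _ _ (CrossedProduct.hasSum_coeff_mul_star α hπ y)
    have h := key (star x)
    simp only [star_star] at h
    -- Reindexing by inversion pairs `c_{t⁻¹}(x*) = t.c_t(x)*` with `c_t(x)`. Both terms then equal
    -- `φ₀(t.(c_t(x)* c_t(x)))`.
    rw [h, key x, ← (Equiv.inv G).tsum_eq]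
    refine tsum_congr fun t => ?_
    rw [← hφ₀.map_star_mul_self (CrossedProduct.coeff α hπ x t),
      ← hinv t ⟨_, star_mul_self_nonneg (CrossedProduct.coeff α hπ x t)⟩]
    refine congrArg φ₀ (Subtype.ext ?_)
    simp only [Equiv.inv_apply, CrossedProduct.coeff_star, inv_inv, star_star, map_mul, map_star]
  · refine hlsc.comp (Continuous.subtype_mk
      ((CrossedProduct.condExp α hπ).continuous.comp continuous_subtype_val) _)
  · refine congrArg φ₀ (Subtype.ext ?_)
    exact (CrossedProduct.condExp_single α hπ 1 (a : A)).trans (if_pos rfl)
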